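/- **Setting.** Let $\mathrm{Sym}(3)$ be the space of real symmetric $3\times3$ matrices with the inner product $\langle X,Y\rangle=\operatorname{tr}(XY^T)$, and $\mathrm{Sym}^{++}(3)$ the positive definite ones. Let $\widehat\sigma:\mathrm{Sym}(3)\to\mathrm{Sym}(3)$ be differentiable and such that the Cauchy stress law $\sigma(B):=\widehat\sigma(\log B)$, $B\in\mathrm{Sym}^{++}(3)$ ($\log$ the principal matrix logarithm), is isotropic: $\sigma(QBQ^T)=Q\,\sigma(B)\,Q^T$ for all $Q\in\mathrm O(3)$, $B\in\mathrm{Sym}^{++}(3)$. No stored energy is assumed. A motion $\varphi(x,t)$ of an open body is a family of $C^1$ diffeomorphisms of the body onto its image, with deformation gradient $F=\mathrm D_x\varphi$, $\det F>0$, differentiable in $t$ at each material point. Along it put $B=FF^T$, $L=\dot F F^{-1}$, $D=\operatorname{sym}L=\frac12(L+L^T)$, $W=\operatorname{skew}L=\frac12(L-L^T)$, and let $$\frac{\mathrm D^{\mathrm{ZJ}}}{\mathrm Dt}[\sigma]=\frac{\mathrm d}{\mathrm dt}[\sigma(B)]-W\sigma+\sigma W$$ be the Zaremba–Jaumann rate,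 where $\frac{\mathrm d}{\mathrm dt}$ is the time derivative at fixed $x$. The *corotational stability postulate* (CSP) holds at $F_0$ with $\det F_0>0$ if $\langle\frac{\mathrm D^{\mathrm{ZJ}}}{\mathrm Dt}[\sigma],D\rangle>0$ for every motion, material point and time at which $F=F_0$ and $D\neq0$; CSP holds if it holds at every such $F_0$. For a linear map $A$ of a finite-dimensional real inner product space let $\operatorname{sym}A=\frac12(A+A^T)$, $A^T$ being the adjoint. A symmetric linear map $\mathbb C$ of $\mathrm{Sym}(3)$ lies in $\mathrm{Sym}_4^{++}(6)$ if $\langle\mathbb C.H,H\rangle>0$ for all $H\in\mathrm{Sym}(3)\setminus\{0\}$. A map is *strongly (Hilbert-)monotone* if it is differentiable and $\langle\mathrm Df(X).H,H\rangle>0$ for all $X$ and all $H\ne0$. For $\lambda\in(0,\infty)^3$, $\widehat\sigma(\log\lambda)=(\widehat\sigma_1,\widehat\sigma_2,\widehat\sigma_3)$ denotes the vector of principal Cauchy stresses as a function of $\log\lambda=(\log\lambda_1,\log\lambda_2,\log\lambda_3)$, i.e. the diagonal entries of the stress $\sigma(B)$ for $B=\operatorname{diag}(\lambda_1^2,\lambda_2^2,\lambda_3^2)$.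 **Theorem.** 1. For every $F$ with $\det F>0$ and $B=FF^T$: CSP holds at $F$ if and only if $\operatorname{sym}\mathrm D_{\log B}\widehat\sigma(\log B)\in\mathrm{Sym}^{++}_4(6)$. 2. The following are equivalent: (a) CSP; (b) (TSTS-M$^{++}$) $\operatorname{sym}\mathrm D_{\log B}\widehat\sigma(\log B)\in\mathrm{Sym}_4^{++}(6)$ for all $B\in\mathrm{Sym}^{++}(3)$; (c) $\log B\mapsto\widehat\sigma(\log B)$ is strongly Hilbert-monotone; (d) $\operatorname{sym}\mathrm D_{\log\lambda}\widehat\sigma(\log\lambda)\in\mathrm{Sym}^{++}(3)$ for all $\lambda\in(0,\infty)^3$. 3. CSP implies the strict monotonicity (TSTS-M$^+$) $\langle\widehat\sigma(\log B_1)-\widehat\sigma(\log B_2),\log B_1-\log B_2\rangle>0$ for all $B_1\ne B_2$ in $\mathrm{Sym}^{++}(3)$, and the strict Baker–Ericksen inequalities (BE$^+$) $(\widehat\sigma_i-\widehat\sigma_j)(\lambda_i-\lambda_j)>0$ for all $\lambda\in(0,\infty)^3$ and $i,j$ with $\lambda_i\neq\lambda_j$. -/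

import Mathlib

open Matrix

attribute [local instance] Matrix.frobeniusNormedAddCommGroup Matrix.frobeniusNormedSpace

/-- Second order tensors in dimension three. -/
abbrev Mat3 := Matrix (Fin 3) (Fin 3) ℝ

/-- Points and vectors of Euclidean space. -/
abbrev E3 := EuclideanSpace ℝ (Fin 3)

/-- The Frobenius inner product `⟨X, Y⟩ = tr (X Yᵀ)` on second order tensors. -/
noncomputable instance Mat3.instInnerProductSpace : InnerProductSpace ℝ Mat3 where
  inner X Y := (X * Yᵀ).trace
  norm_sq_eq_re_inner X := by
    rw [Matrix.frobenius_norm_def, ← Real.sqrt_eq_rpow, Real.sq_sqrt (by positivity)]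
    simp [Matrix.trace, Matrix.mul_apply, pow_two]
  conj_inner_symm X Y := by
    simp [Matrix.trace, Matrix.mul_apply, mul_comm]
  add_left X Y Z := by simp [Matrix.add_mul]
  smul_left X Y r := by simp

/-- The space `Sym(3)` of symmetric tensors, with the inner product inherited from `Mat3`. -/
def Sym3 : Submodule ℝ Mat3 where
  carrier := {A | A.IsSymm}
  add_mem' := fun hA hB => Matrix.IsSymm.add hA hB
  zero_mem' := Matrix.isSymm_zero
  smul_mem' := fun c _ hA => Matrix.IsSymm.smul hA c

/-! ### Linear maps on a Euclidean space: symmetric part, positive definiteness, monotonicity -/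

section Operators

variable {H : Type*} [NormedAddCommGroup H] [InnerProductSpace ℝ H] [CompleteSpace H]

/-- The symmetric part `½ (A + Aᵀ)` of a linear map. For `H = Sym3` the linear maps are the
fourth order tensors with both minor symmetries, and the transposition is the major one. -/
noncomputable def symPart (A : H →L[ℝ] H) : H →L[ℝ] H :=
  (1 / 2 : ℝ) • (A + ContinuousLinearMap.adjoint A)

/-- Symmetric positive definite linear maps. For `H = Sym3` this is the set `Sym⁺⁺₄(6)` of
positive definite, minor and major symmetric fourth order tensors; for `H = E3` it is
`Sym⁺⁺(3)`. -/
def IsSymPosDef (A : H →L[ℝ] H) : Prop :=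
  IsSelfAdjoint A ∧ ∀ h : H, h ≠ 0 → 0 < inner ℝ (A h) h

/-- Strong monotonicity: differentiable, with everywhere positive definite (not necessarily
symmetric) derivative. -/
def StronglyMonotone (f : H → H) : Prop :=
  Differentiable ℝ f ∧ ∀ x h : H, h ≠ 0 → 0 < inner ℝ (fderiv ℝ f x h) h

end Operators

/-! ### Constitutive law -/

/-- The principal matrix logarithm of a positive definite tensor (through the spectral
decomposition: eigenvalues `b` are replaced by `Real.log b`, eigenvectors are kept). -/
noncomputable def matLog (B : Mat3) : Sym3 :=
  ⟨cfc Real.log B, by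
    have h : IsSelfAdjoint (cfc Real.log B) := cfc_predicate Real.log B
    change (cfc Real.log B)ᵀ = cfc Real.log B
    rw [← Matrix.conjTranspose_eq_transpose_of_trivial]
    exact h⟩

/-- The Cauchy stress `σ(B) = σ̂(log B)`, as a function of the left Cauchy-Green tensor `B`. -/
noncomputable def cauchyStress (sigHat : Sym3 → Sym3) (B : Mat3) : Mat3 :=
  (sigHat (matLog B) : Mat3)

/-- Isotropy of `B ↦ σ(B)` on the positive definite tensors:
`σ(Q B Qᵀ) = Q σ(B) Qᵀ` for all orthogonal `Q`. -/
def IsIsotropic (sigma : Mat3 → Mat3) : Prop :=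
  ∀ B : Mat3, B.PosDef → ∀ Q ∈ Matrix.orthogonalGroup (Fin 3) ℝ,
    sigma (Q * B * Qᵀ) = Q * sigma B * Qᵀ

/-! ### Kinematics -/

/-- The deformation gradient: the Jacobian matrix at `x` of a map of space. -/
noncomputable def jacobianMatrix (f : E3 → E3) (x : E3) : Mat3 :=
  Matrix.of fun i j => fderiv ℝ f x (EuclideanSpace.single j 1) i

/-- A motion of a body: a time dependent family of orientation preserving `C¹` diffeomorphisms
of the reference body onto its image, whose deformation gradient at each material point is
differentiable in time. -/
structure Motion where
  body : Set E3
  isOpen_body : IsOpen body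
  map : ℝ → E3 → E3
  contDiffOn_map : ∀ t, ContDiffOn ℝ 1 (map t) body
  injOn_map : ∀ t, Set.InjOn (map t) body
  det_pos : ∀ t, ∀ x ∈ body, 0 < (jacobianMatrix (map t) x).det
  differentiable_gradient : ∀ x ∈ body, Differentiable ℝ fun t => jacobianMatrix (map t) x

namespace Motion

/-- Deformation gradient `F`. -/
noncomputable def F (m : Motion) (x : E3) (t : ℝ) : Mat3 := jacobianMatrix (m.map t) x

/-- Left Cauchy-Green tensor `B = F Fᵀ`. -/
noncomputable def B (m : Motion) (x : E3) (t : ℝ) : Mat3 := m.F x t * (m.F x t)ᵀ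

/-- Spatial velocity gradient `L = Ḟ F⁻¹` (at the material point `x`). -/
noncomputable def L (m : Motion) (x : E3) (t : ℝ) : Mat3 := deriv (m.F x) t * (m.F x t)⁻¹

/-- Strain rate `D = sym L`. -/
noncomputable def D (m : Motion) (x : E3) (t : ℝ) : Mat3 :=
  (1 / 2 : ℝ) • (m.L x t + (m.L x t)ᵀ)

/-- Vorticity `W = skew L`. -/
noncomputable def W (m : Motion) (x : E3) (t : ℝ) : Mat3 :=
  (1 / 2 : ℝ) • (m.L x t - (m.L x t)ᵀ)

/-- The Zaremba-Jaumann rate `dσ/dt - W σ + σ W` of the Cauchy stress along the motion, with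
`d/dt` the material time derivative. -/
noncomputable def zjRate (sigHat : Sym3 → Sym3) (m : Motion) (x : E3) (t : ℝ) : Mat3 :=
  deriv (fun s => cauchyStress sigHat (m.B x s)) t
    - m.W x t * cauchyStress sigHat (m.B x t)
    + cauchyStress sigHat (m.B x t) * m.W x t

end Motion

/-! ### Constitutive conditions -/

/-- The corotational stability postulate at the deformation gradient `F₀`: whenever a motion has
deformation gradient `F₀` at some point and time and strain rate `D ≠ 0` there,
`⟨D^ZJ σ / Dt, D⟩ > 0`. -/
def CSPAt (sigHat : Sym3 → Sym3) (F₀ : Mat3) : Prop :=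
  ∀ (m : Motion) (x : E3) (t : ℝ), x ∈ m.body → m.F x t = F₀ → m.D x t ≠ 0 →
    0 < inner ℝ (m.zjRate sigHat x t) (m.D x t)

/-- The corotational stability postulate (CSP), at all deformation gradients in `GL⁺(3)`. -/
def CSP (sigHat : Sym3 → Sym3) : Prop :=
  ∀ F₀ : Mat3, 0 < F₀.det → CSPAt sigHat F₀

/-- TSTS-M⁺⁺ at `B`: the symmetric part of the derivative of `σ̂` at `log B` is in `Sym⁺⁺₄(6)`. -/
def TSTSMppAt (sigHat : Sym3 → Sym3) (B : Mat3) : Prop :=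
  IsSymPosDef (symPart (fderiv ℝ sigHat (matLog B)))

/-- TSTS-M⁺⁺. -/
def TSTSMpp (sigHat : Sym3 → Sym3) : Prop :=
  ∀ B : Mat3, B.PosDef → TSTSMppAt sigHat B

/-- TSTS-M⁺: strict Hilbert-monotonicity of the Cauchy stress in `log B`. -/
def TSTSMp (sigHat : Sym3 → Sym3) : Prop :=
  ∀ B₁ B₂ : Mat3, B₁.PosDef → B₂.PosDef → B₁ ≠ B₂ →
    0 < inner ℝ (sigHat (matLog B₁) - sigHat (matLog B₂)) (matLog B₁ - matLog B₂)

/-- The vector `(σ̂₁, σ̂₂, σ̂₃)` of principal Cauchy stresses as a function of the principal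
logarithmic strains `yᵢ = log λᵢ`, where `λᵢ` are the eigenvalues of `V = √B`: the diagonal
entries of `σ̂(log B)` for `log B = 2 log V = diag(2 y₁, 2 y₂, 2 y₃)`. -/
noncomputable def principalStress (sigHat : Sym3 → Sym3) (y : E3) : E3 :=
  WithLp.toLp 2 fun i =>
    (sigHat ⟨Matrix.diagonal fun j => 2 * y j, Matrix.isSymm_diagonal _⟩ : Mat3) i i

/-- The principal logarithmic strains `(log λ₁, log λ₂, log λ₃)`. -/
noncomputable def logVec (lam : Fin 3 → ℝ) : E3 := WithLp.toLp 2 fun i => Real.log (lam i)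

/-- `sym D_{log λ} σ̂(log λ) ∈ Sym⁺⁺(3)` for all principal stretches `λ`. -/
def PrincipalTSTSMpp (sigHat : Sym3 → Sym3) : Prop :=
  ∀ lam : Fin 3 → ℝ, (∀ i, 0 < lam i) →
    IsSymPosDef (symPart (fderiv ℝ (principalStress sigHat) (logVec lam)))

/-- The strict Baker-Ericksen inequalities BE⁺: `(σᵢ - σⱼ)(λᵢ - λⱼ) > 0` for `λᵢ ≠ λⱼ`. -/
def BakerEricksen (sigHat : Sym3 → Sym3) : Prop :=
  ∀ lam : Fin 3 → ℝ, (∀ i, 0 < lam i) → ∀ i j : Fin 3, lam i ≠ lam j →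
    0 < (principalStress sigHat (logVec lam) i - principalStress sigHat (logVec lam) j)
      * (lam i - lam j)

section TensorAnalysis

attribute [local instance] Matrix.frobeniusNormedRing Matrix.frobeniusNormedAlgebra

/-! ### Linear operations on symmetric tensors -/

/-! Isotropy makes `sigHat` equivariant under orthogonal congruences of `X = log B`. Differentiated
along a rotation group with skew generator `W`, this says that the derivative sends `W X - X W` to
`W σ - σ W`. Since `B` evolves by `L B + B Lᵀ` with `L = D + W`, the vorticity enters the material
derivative of the stress exactly as `W σ - σ W`, which the Zaremba–Jaumann correction removes. What
remains is `Dσ̂(X)` applied to `logRate X D`, where `logRate X` is `D ↦ B D + D B` followed by the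
derivative of the logarithm (`zjRate_eq`).

In an eigenbasis of `X`, equivariance under coordinate reflections puts `Dσ̂(X)` in block form: a
linear map on diagonals, and a scalar `c i j` on each off-diagonal entry. Its quadratic form is
positive iff the diagonal block is positive and every `c i j > 0` (`IsBlockForm.posDef_iff`).
`logRate X` doubles diagonals and scales off-diagonal entries by positive factors, so composing with
it does not affect positivity. This gives the pointwise equivalence.

The diagonal block is, up to a factor 2, the derivative of the principal stresses. Each `c i j` is a
divided difference of them, or a directional value of the diagonal block at equal eigenvalues.
Monotonicity of the principal stresses therefore already forces `c i j > 0`, and the Baker–Ericksen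
inequalities are the same sign condition. -/

lemma sym3_transpose (X : Sym3) : (X : Mat3)ᵀ = X := X.2

/-- The orthogonal projection `A ↦ ½ (A + Aᵀ)` onto the symmetric tensors. -/
noncomputable def symProj : Mat3 →L[ℝ] Sym3 :=
  LinearMap.toContinuousLinearMap
    { toFun := fun A => ⟨(1 / 2 : ℝ) • (A + Aᵀ), by
        change ((1 / 2 : ℝ) • (A + Aᵀ))ᵀ = _
        simp [add_comm]⟩
      map_add' := fun A B => by
        apply Subtype.ext
        simp only [Submodule.coe_add, transpose_add, ← smul_add]
        congr 1; abel
      map_smul' := fun c A => by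
        apply Subtype.ext
        simp only [Submodule.coe_smul, transpose_smul, ← smul_add, RingHom.id_apply]
        rw [smul_comm] }

lemma symProj_coe (X : Sym3) : symProj (X : Mat3) = X := by
  apply Subtype.ext
  change (1 / 2 : ℝ) • ((X : Mat3) + (X : Mat3)ᵀ) = X
  rw [sym3_transpose X, ← two_smul ℝ (X : Mat3), smul_smul]
  norm_num

/-- The congruence `X ↦ Q X Qᵀ`. -/
noncomputable def congrSym (Q : Mat3) : Sym3 →L[ℝ] Sym3 :=
  LinearMap.toContinuousLinearMap
    { toFun := fun X => ⟨Q * (X : Mat3) * Qᵀ, by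
        change (Q * (X : Mat3) * Qᵀ)ᵀ = _
        simp [Matrix.mul_assoc, sym3_transpose X]⟩
      map_add' := fun A B => by
        apply Subtype.ext
        simp [Matrix.mul_add, Matrix.add_mul]
      map_smul' := fun c A => by
        apply Subtype.ext
        simp }

/-- The infinitesimal congruence `X ↦ W X + X Wᵀ`. -/
noncomputable def lieSym (W : Mat3) : Sym3 →L[ℝ] Sym3 :=
  LinearMap.toContinuousLinearMap
    { toFun := fun X => ⟨W * (X : Mat3) + (X : Mat3) * Wᵀ, by
        change (W * (X : Mat3) + (X : Mat3) * Wᵀ)ᵀ = _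
        simp [sym3_transpose X, add_comm]⟩
      map_add' := fun A B => by
        apply Subtype.ext
        simp only [Submodule.coe_add, Matrix.mul_add, Matrix.add_mul]
        abel
      map_smul' := fun c A => by
        apply Subtype.ext
        simp }

/-- The diagonal tensor with given diagonal. -/
noncomputable def diagSym : E3 →L[ℝ] Sym3 :=
  LinearMap.toContinuousLinearMap
    { toFun := fun d => ⟨Matrix.diagonal d, Matrix.isSymm_diagonal _⟩
      map_add' := fun A B => by
        apply Subtype.ext
        simp
      map_smul' := fun c A => by
        apply Subtype.ext
        simp }

/-- The diagonal of a symmetric tensor. -/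
noncomputable def diagPart : Sym3 →L[ℝ] E3 :=
  LinearMap.toContinuousLinearMap
    { toFun := fun X => WithLp.toLp 2 fun i => (X : Mat3) i i
      map_add' := fun A B => by
        ext i
        simp
      map_smul' := fun c A => by
        ext i
        simp }

@[simp] lemma congrSym_coe (Q : Mat3) (X : Sym3) : (congrSym Q X : Mat3) = Q * X * Qᵀ := rfl

@[simp] lemma lieSym_coe (W : Mat3) (X : Sym3) : (lieSym W X : Mat3) = W * X + X * Wᵀ := rfl

@[simp] lemma diagSym_coe (d : E3) : (diagSym d : Mat3) = Matrix.diagonal d := rfl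

@[simp] lemma diagPart_apply (X : Sym3) (i : Fin 3) : diagPart X i = (X : Mat3) i i := rfl

lemma lieSym_add (V W : Mat3) (X : Sym3) : lieSym (V + W) X = lieSym V X + lieSym W X := by
  apply Subtype.ext
  simp only [lieSym_coe, Submodule.coe_add, Matrix.add_mul, transpose_add, Matrix.mul_add]
  abel

lemma congrSym_congrSym (P Q : Mat3) (X : Sym3) :
    congrSym P (congrSym Q X) = congrSym (P * Q) X := by
  apply Subtype.ext
  simp [Matrix.mul_assoc]

lemma congrSym_one (X : Sym3) : congrSym 1 X = X := by
  apply Subtype.ext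
  simp

lemma transpose_mul_self_of_orthogonal {Q : Mat3} (hQ : Q ∈ Matrix.orthogonalGroup (Fin 3) ℝ) :
    Qᵀ * Q = 1 := (Matrix.mem_orthogonalGroup_iff' _ _).1 hQ

lemma self_mul_transpose_of_orthogonal {Q : Mat3} (hQ : Q ∈ Matrix.orthogonalGroup (Fin 3) ℝ) :
    Q * Qᵀ = 1 := mul_eq_one_comm.1 (transpose_mul_self_of_orthogonal hQ)

lemma transpose_mem_orthogonal {Q : Mat3} (hQ : Q ∈ Matrix.orthogonalGroup (Fin 3) ℝ) :
    Qᵀ ∈ Matrix.orthogonalGroup (Fin 3) ℝ := by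
  rw [Matrix.mem_orthogonalGroup_iff]
  simpa [Matrix.star_eq_conjTranspose] using transpose_mul_self_of_orthogonal hQ

lemma mem_orthogonal_of_mul_transpose {Q : Mat3} (hQ : Q * Qᵀ = 1) :
    Q ∈ Matrix.orthogonalGroup (Fin 3) ℝ := by
  rw [Matrix.mem_orthogonalGroup_iff]
  simpa [Matrix.star_eq_conjTranspose] using hQ

lemma congrSym_transpose_congrSym {Q : Mat3} (hQ : Q ∈ Matrix.orthogonalGroup (Fin 3) ℝ)
    (X : Sym3) : congrSym Qᵀ (congrSym Q X) = X := by
  rw [congrSym_congrSym, transpose_mul_self_of_orthogonal hQ, congrSym_one]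

lemma congrSym_congrSym_transpose {Q : Mat3} (hQ : Q ∈ Matrix.orthogonalGroup (Fin 3) ℝ)
    (X : Sym3) : congrSym Q (congrSym Qᵀ X) = X := by
  rw [congrSym_congrSym, self_mul_transpose_of_orthogonal hQ, congrSym_one]

lemma inner_sym_eq (X Y : Sym3) :
    inner ℝ X Y = ((X : Mat3) * (Y : Mat3)).trace := by
  change ((X : Mat3) * (Y : Mat3)ᵀ).trace = _
  rw [sym3_transpose Y]

lemma inner_congrSym {Q : Mat3} (hQ : Q ∈ Matrix.orthogonalGroup (Fin 3) ℝ) (X Y : Sym3) :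
    inner ℝ (congrSym Q X) (congrSym Q Y) = inner ℝ X Y := by
  have h := transpose_mul_self_of_orthogonal hQ
  simp only [inner_sym_eq, congrSym_coe]
  calc (Q * X * Qᵀ * (Q * Y * Qᵀ)).trace = (Q * (X * (Qᵀ * Q) * Y * Qᵀ)).trace := by
        simp only [Matrix.mul_assoc]
    _ = _ := by
        rw [h, Matrix.mul_one, Matrix.trace_mul_comm, Matrix.mul_assoc, h, Matrix.mul_one]

/-- Every symmetric tensor is orthogonally diagonalizable. -/
lemma exists_congrSym_diagSym (X : Sym3) :
    ∃ Q ∈ Matrix.orthogonalGroup (Fin 3) ℝ, ∃ x : E3, X = congrSym Q (diagSym x) := by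
  have hX : (X : Mat3).IsHermitian := by
    rw [Matrix.IsHermitian, conjTranspose_eq_transpose_of_trivial, sym3_transpose X]
  refine ⟨hX.eigenvectorUnitary, hX.eigenvectorUnitary.2, WithLp.toLp 2 hX.eigenvalues, ?_⟩
  apply Subtype.ext
  have := hX.spectral_theorem
  rw [Unitary.conjStarAlgAut_apply] at this
  simpa [Matrix.star_eq_conjTranspose] using this

/-! ### Exponential and logarithm -/

/-- The matrix exponential on symmetric tensors. -/
noncomputable def expSym (X : Sym3) : Sym3 := ⟨NormedSpace.exp (X : Mat3), X.2.exp⟩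

lemma expSym_coe (X : Sym3) : (expSym X : Mat3) = NormedSpace.exp (X : Mat3) := rfl

lemma sym3_isSelfAdjoint (X : Sym3) : IsSelfAdjoint (X : Mat3) := by
  rw [IsSelfAdjoint, Matrix.star_eq_conjTranspose, conjTranspose_eq_transpose_of_trivial,
    sym3_transpose X]

lemma matLog_expSym (X : Sym3) : matLog (expSym X) = X := by
  -- `CFC.log_exp` needs a normed algebra, so the Hermitian functional calculus is read with the
  -- ring and algebra structures of the Frobenius norm.
  have h : @ContinuousFunctionalCalculus ℝ Mat3 IsSelfAdjoint _ _ _ _ _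
      (Matrix.frobeniusNormedRing.toRing) _ _
      (Matrix.frobeniusNormedAlgebra.toAlgebra) :=
    Matrix.IsHermitian.instContinuousFunctionalCalculus
  exact Subtype.ext (@CFC.log_exp Mat3 Matrix.frobeniusNormedRing _
    Matrix.frobeniusNormedAlgebra h (X : Mat3) (sym3_isSelfAdjoint X))

lemma expSym_diagSym (x : E3) :
    expSym (diagSym x) = diagSym (WithLp.toLp 2 fun i => Real.exp (x i)) := by
  apply Subtype.ext
  rw [expSym_coe, diagSym_coe, Matrix.exp_diagonal, diagSym_coe]
  congr 1
  funext i
  rw [Pi.coe_exp, ← Real.exp_eq_exp_ℝ]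

lemma expSym_congrSym {Q : Mat3} (hQ : Q ∈ Matrix.orthogonalGroup (Fin 3) ℝ) (X : Sym3) :
    expSym (congrSym Q X) = congrSym Q (expSym X) := by
  apply Subtype.ext
  have h : Q⁻¹ = Qᵀ := Matrix.inv_eq_left_inv (transpose_mul_self_of_orthogonal hQ)
  have hu : IsUnit Q := (Matrix.isUnit_iff_isUnit_det _).2
    (Matrix.isUnit_det_of_left_inverse (transpose_mul_self_of_orthogonal hQ))
  rw [expSym_coe, congrSym_coe, congrSym_coe, ← h, Matrix.exp_conj _ _ hu, expSym_coe]

lemma posDef_congr {Q : Mat3} (hQ : Q ∈ Matrix.orthogonalGroup (Fin 3) ℝ) {B : Mat3}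
    (hB : B.PosDef) : (Q * B * Qᵀ).PosDef := by
  have hu : IsUnit Q := (Matrix.isUnit_iff_isUnit_det _).2
    (Matrix.isUnit_det_of_left_inverse (transpose_mul_self_of_orthogonal hQ))
  have := (Matrix.IsUnit.posDef_star_right_conjugate_iff hu (x := B)).2 hB
  simpa [Matrix.star_eq_conjTranspose] using this

lemma expSym_posDef (X : Sym3) : (expSym X : Mat3).PosDef := by
  obtain ⟨Q, hQ, x, rfl⟩ := exists_congrSym_diagSym X
  rw [expSym_congrSym hQ, congrSym_coe, expSym_diagSym]
  exact posDef_congr hQ (Matrix.PosDef.diagonal fun i => Real.exp_pos _)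

lemma exists_expSym_eq {B : Mat3} (hB : B.PosDef) : ∃ X : Sym3, (expSym X : Mat3) = B := by
  have hs : B.IsSymm := by
    have := hB.isHermitian
    rwa [Matrix.IsHermitian, conjTranspose_eq_transpose_of_trivial] at this
  obtain ⟨Q, hQ, x, hx⟩ := exists_congrSym_diagSym ⟨B, hs⟩
  have hx' : B = Q * Matrix.diagonal x * Qᵀ := congrArg Subtype.val hx
  have hd : (Matrix.diagonal x : Mat3) = Qᵀ * B * Qᵀᵀ := by
    have := congrSym_transpose_congrSym hQ (diagSym x)
    rw [← hx] at this
    exact (congrArg Subtype.val this).symm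
  have hp : (Matrix.diagonal x : Mat3).PosDef := by
    rw [hd]; exact posDef_congr (transpose_mem_orthogonal hQ) hB
  have hpos : ∀ i, 0 < x i := fun i => Matrix.posDef_diagonal_iff.1 hp i
  refine ⟨congrSym Q (diagSym (WithLp.toLp 2 fun i => Real.log (x i))), ?_⟩
  rw [expSym_congrSym hQ, expSym_diagSym, hx']
  simp [Real.exp_log (hpos _)]

lemma expSym_matLog {B : Mat3} (hB : B.PosDef) : (expSym (matLog B) : Mat3) = B := by
  obtain ⟨X, rfl⟩ := exists_expSym_eq hB
  rw [matLog_expSym]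

lemma contDiff_expSym : ContDiff ℝ 1 expSym := by
  have h : ContDiff ℝ 1 (NormedSpace.exp : Mat3 → Mat3) :=
    contDiff_iff_contDiffAt.2 fun A => (NormedSpace.exp_analytic (𝕂 := ℝ) A).contDiffAt
  have : expSym = fun X => symProj (NormedSpace.exp (Sym3.subtypeL X)) := by
    funext X
    rw [← symProj_coe (expSym X)]; rfl
  rw [this]
  exact symProj.contDiff.comp (h.comp Sym3.subtypeL.contDiff)

/-! ### Equivariant maps -/

/-- Equivariance of a tensor function of a symmetric tensor under orthogonal congruences. -/
def OrthEquivariant (T : Sym3 → Sym3) : Prop :=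
  ∀ Q ∈ Matrix.orthogonalGroup (Fin 3) ℝ, ∀ X, T (congrSym Q X) = congrSym Q (T X)

lemma orthEquivariant_expSym : OrthEquivariant expSym := fun _ hQ X => expSym_congrSym hQ X

/-- Every symmetric `X` is the logarithm of the positive definite `exp X`, and the exponential
commutes with congruences, so isotropy in `B` becomes equivariance on all of `Sym3`. -/
lemma IsIsotropic.orthEquivariant {sigHat : Sym3 → Sym3}
    (h : IsIsotropic (cauchyStress sigHat)) : OrthEquivariant sigHat := by
  intro Q hQ X
  have := h _ (expSym_posDef X) Q hQ
  rw [← congrSym_coe, ← expSym_congrSym hQ] at this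
  simp only [cauchyStress, matLog_expSym] at this
  exact Subtype.ext this

lemma exp_smul_mem_orthogonal {W : Mat3} (hW : Wᵀ = -W) (t : ℝ) :
    NormedSpace.exp (t • W) ∈ Matrix.orthogonalGroup (Fin 3) ℝ := by
  apply mem_orthogonal_of_mul_transpose
  rw [← Matrix.exp_transpose, transpose_smul, hW, smul_neg, Matrix.exp_neg]
  exact Matrix.mul_nonsing_inv _ ((Matrix.isUnit_iff_isUnit_det _).1 (Matrix.isUnit_exp _))

lemma hasDerivAt_exp_smul_zero (W : Mat3) :
    HasDerivAt (fun t : ℝ => NormedSpace.exp (t • W)) W 0 := by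
  have h := hasDerivAt_exp_smul_const (𝕂 := ℝ) W 0
  rw [zero_smul, NormedSpace.exp_zero, one_mul] at h
  exact h

lemma hasDerivAt_congrSym_exp (W : Mat3) (X : Sym3) :
    HasDerivAt (fun t : ℝ => congrSym (NormedSpace.exp (t • W)) X) (lieSym W X) 0 := by
  have h1 := hasDerivAt_exp_smul_zero W
  have h2 := hasDerivAt_exp_smul_zero Wᵀ
  have h3 := symProj.hasFDerivAt.comp_hasDerivAt (0 : ℝ) ((h1.mul_const (X : Mat3)).mul h2)
  have e1 : (fun t : ℝ => congrSym (NormedSpace.exp (t • W)) X)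
      = symProj ∘ ((fun t : ℝ => NormedSpace.exp (t • W) * (X : Mat3)) *
        fun t : ℝ => NormedSpace.exp (t • Wᵀ)) := by
    funext t
    rw [← symProj_coe (congrSym _ X)]
    simp [← Matrix.exp_transpose]
  have e2 : lieSym W X = symProj (W * (X : Mat3) * NormedSpace.exp ((0 : ℝ) • Wᵀ)
      + NormedSpace.exp ((0 : ℝ) • W) * (X : Mat3) * Wᵀ) := by
    rw [← symProj_coe (lieSym _ X)]
    simp
  rw [e1, e2]
  exact h3

/-- Differentiating equivariance under the one-parameter group generated by `W`. -/
lemma fderiv_lieSym {T : Sym3 → Sym3} {X : Sym3} (hT : DifferentiableAt ℝ T X) {W : Mat3}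
    (h : ∀ t : ℝ, T (congrSym (NormedSpace.exp (t • W)) X)
      = congrSym (NormedSpace.exp (t • W)) (T X)) :
    fderiv ℝ T X (lieSym W X) = lieSym W (T X) := by
  have h0 : congrSym (NormedSpace.exp ((0 : ℝ) • W)) X = X := by
    rw [zero_smul, NormedSpace.exp_zero, congrSym_one]
  have h1 : HasFDerivAt T (fderiv ℝ T X) (congrSym (NormedSpace.exp ((0 : ℝ) • W)) X) := by
    rw [h0]; exact hT.hasFDerivAt
  have h2 := h1.comp_hasDerivAt (0 : ℝ) (hasDerivAt_congrSym_exp W X)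
  have h3 := hasDerivAt_congrSym_exp W (T X)
  have e : (T ∘ fun t : ℝ => congrSym (NormedSpace.exp (t • W)) X)
      = fun t : ℝ => congrSym (NormedSpace.exp (t • W)) (T X) := funext h
  rw [e] at h2
  exact h2.unique h3

lemma OrthEquivariant.fderiv_lieSym {T : Sym3 → Sym3} (hE : OrthEquivariant T) {X : Sym3}
    (hT : DifferentiableAt ℝ T X) {W : Mat3} (hW : Wᵀ = -W) :
    fderiv ℝ T X (lieSym W X) = lieSym W (T X) :=
  _root_.fderiv_lieSym hT fun t => hE _ (exp_smul_mem_orthogonal hW t) X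

lemma OrthEquivariant.fderiv_congrSym {T : Sym3 → Sym3} (hE : OrthEquivariant T) {X : Sym3}
    (hT : Differentiable ℝ T) {Q : Mat3} (hQ : Q ∈ Matrix.orthogonalGroup (Fin 3) ℝ) (H : Sym3) :
    fderiv ℝ T (congrSym Q X) (congrSym Q H) = congrSym Q (fderiv ℝ T X H) := by
  have h1 := (hT (congrSym Q X)).hasFDerivAt.comp X (congrSym Q).hasFDerivAt
  have h2 := (congrSym Q).hasFDerivAt.comp X (hT X).hasFDerivAt
  have h3 : T ∘ congrSym Q = congrSym Q ∘ T := funext fun Y => hE Q hQ Y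
  rw [h3] at h1
  exact DFunLike.congr_fun (h1.unique h2) H

/-! ### Block form of equivariant linear maps -/

/-- The symmetric tensor with entries one at `(i, j)` and `(j, i)`. -/
noncomputable def offSym (i j : Fin 3) : Sym3 :=
  ⟨Matrix.single i j 1 + Matrix.single j i 1, by
    change (Matrix.single i j (1 : ℝ) + Matrix.single j i 1)ᵀ = _
    simp [add_comm]⟩

lemma offSym_coe (i j : Fin 3) :
    (offSym i j : Mat3) = Matrix.single i j 1 + Matrix.single j i 1 := rfl

lemma offSym_apply_self {i j : Fin 3} (h : i ≠ j) : (offSym i j : Mat3) i j = 1 := by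
  simp [offSym_coe, Matrix.add_apply, h, h.symm]

/-- The generator of the rotations in the plane of the coordinates `i` and `j`. -/
noncomputable def rotGen (i j : Fin 3) : Mat3 := Matrix.single i j 1 - Matrix.single j i 1

lemma rotGen_transpose (i j : Fin 3) : (rotGen i j)ᵀ = -rotGen i j := by
  simp [rotGen]

/-- The tangent to a rotation orbit at a diagonal tensor is off-diagonal, scaled by the eigenvalue
gap. It vanishes at equal eigenvalues, hence the two cases for the coefficients below. -/
lemma lieSym_rotGen_diagSym (i j : Fin 3) (x : E3) :
    lieSym (rotGen i j) (diagSym x) = (x j - x i) • offSym i j := by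
  apply Subtype.ext
  rw [lieSym_coe, diagSym_coe, rotGen_transpose, rotGen, Submodule.coe_smul, offSym_coe]
  ext a b
  simp only [Matrix.mul_neg, Matrix.add_apply, Matrix.neg_apply, Matrix.mul_diagonal,
    Matrix.diagonal_mul, Matrix.sub_apply, Matrix.smul_apply, Matrix.single_apply, smul_eq_mul]
  by_cases h1 : i = a ∧ j = b <;> by_cases h2 : j = a ∧ i = b
  · rw [if_pos h1, if_pos h2, ← h1.1, ← h2.2]; ring_nf; rw [h2.1, h1.1]; ring
  · rw [if_pos h1, if_neg h2, h1.1, h1.2]; ring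
  · rw [if_neg h1, if_pos h2, h2.1, h2.2]; ring
  · rw [if_neg h1, if_neg h2]; ring

/-- The reflection in the `k`-th coordinate plane. -/
noncomputable def reflMat (k : Fin 3) : Mat3 := Matrix.diagonal fun a => if a = k then -1 else 1

lemma reflMat_mem (k : Fin 3) : reflMat k ∈ Matrix.orthogonalGroup (Fin 3) ℝ := by
  apply mem_orthogonal_of_mul_transpose
  rw [reflMat, Matrix.diagonal_transpose, Matrix.diagonal_mul_diagonal, ← Matrix.diagonal_one]
  congr 1
  funext a
  split_ifs <;> norm_num

lemma congrSym_reflMat_apply (k : Fin 3) (H : Sym3) (a b : Fin 3) :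
    (congrSym (reflMat k) H : Mat3) a b =
      (if a = k then -1 else 1) * (H : Mat3) a b * (if b = k then -1 else 1) := by
  rw [congrSym_coe, reflMat, Matrix.diagonal_transpose, Matrix.mul_diagonal, Matrix.diagonal_mul]

lemma congrSym_reflMat_diagSym (k : Fin 3) (x : E3) :
    congrSym (reflMat k) (diagSym x) = diagSym x := by
  apply Subtype.ext
  ext a b
  rw [congrSym_reflMat_apply, diagSym_coe, Matrix.diagonal_apply]
  split_ifs <;> simp_all

lemma sym3_apply_comm (H : Sym3) (i j : Fin 3) : (H : Mat3) i j = (H : Mat3) j i :=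
  H.2.apply j i

/-- An off-diagonal entry changes sign under exactly two of the three reflections, so it cancels in
the sum with the identity; diagonal entries never change. -/
lemma add_sum_congrSym_reflMat (H : Sym3) :
    H + ∑ k, congrSym (reflMat k) H = (4 : ℝ) • diagSym (diagPart H) := by
  apply Subtype.ext
  ext a b
  simp only [Fin.sum_univ_three, Submodule.coe_add, Submodule.coe_smul, Matrix.add_apply,
    Matrix.smul_apply, congrSym_reflMat_apply, diagSym_coe]
  fin_cases a <;> fin_cases b <;> simp <;> ring

/-- Character orthogonality: weighting each reflection by its sign on entry `(i, j)` keeps only the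
entries with that same sign pattern. -/
lemma add_sum_smul_congrSym_reflMat (H : Sym3) {i j : Fin 3} (hij : i ≠ j) :
    H + ∑ k, ((if i = k then -1 else 1) * (if j = k then -1 else 1) : ℝ) •
      congrSym (reflMat k) H = (4 * (H : Mat3) i j) • offSym i j := by
  apply Subtype.ext
  ext a b
  simp only [Fin.sum_univ_three, Submodule.coe_add, Submodule.coe_smul, Matrix.add_apply,
    Matrix.smul_apply, congrSym_reflMat_apply, offSym_coe]
  have h10 := sym3_apply_comm H 1 0
  have h20 := sym3_apply_comm H 2 0
  have h21 := sym3_apply_comm H 2 1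
  fin_cases i <;> fin_cases j <;> first
    | exact absurd rfl hij
    | (fin_cases a <;> fin_cases b <;> simp [h10, h20, h21] <;> ring)

/-- `M` maps diagonal tensors to diagonal tensors, and multiplies the entry `(i, j)`, `i ≠ j`,
of a symmetric tensor by `c i j`. -/
structure IsBlockForm (M : Sym3 →L[ℝ] Sym3) (c : Fin 3 → Fin 3 → ℝ) : Prop where
  off : ∀ H : Sym3, ∀ i j, i ≠ j → (M H : Mat3) i j = c i j * (H : Mat3) i j
  diag : ∀ H : Sym3, diagPart (M H) = diagPart (M (diagSym (diagPart H)))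

/-- `M` commutes with both reflection averages, hence with the projections onto the diagonal and
onto each `offSym i j`. -/
lemma isBlockForm_of_commute_reflMat {M : Sym3 →L[ℝ] Sym3}
    (hM : ∀ k H, M (congrSym (reflMat k) H) = congrSym (reflMat k) (M H)) :
    IsBlockForm M fun i j => (M (offSym i j) : Mat3) i j where
  off H i j hij := by
    have h := congrArg M (add_sum_smul_congrSym_reflMat H hij)
    simp only [map_add, map_sum, map_smul, hM] at h
    have h' := congrFun (congrFun (congrArg Subtype.val h) i) j
    simp only [Fin.sum_univ_three, Submodule.coe_add, Submodule.coe_smul, Matrix.add_apply,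
      Matrix.smul_apply, congrSym_reflMat_apply, smul_eq_mul] at h'
    have e : ∀ k : Fin 3, ((if i = k then -1 else 1) * (if j = k then -1 else 1) : ℝ) *
        ((if i = k then -1 else 1) * (M H : Mat3) i j * (if j = k then -1 else 1))
        = (M H : Mat3) i j := by
      intro k
      split_ifs <;> ring
    rw [e, e, e] at h'
    linarith
  diag H := by
    ext i
    have h := congrArg M (add_sum_congrSym_reflMat H)
    simp only [map_add, map_sum, map_smul, hM] at h
    have h' := congrFun (congrFun (congrArg Subtype.val h) i) i
    simp only [Fin.sum_univ_three, Submodule.coe_add, Submodule.coe_smul, Matrix.add_apply,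
      Matrix.smul_apply, congrSym_reflMat_apply, smul_eq_mul] at h'
    have e : ∀ k : Fin 3, ((if i = k then -1 else 1) * (M H : Mat3) i i *
        (if i = k then -1 else 1) : ℝ) = (M H : Mat3) i i := by
      intro k
      split_ifs <;> ring
    rw [e, e, e] at h'
    rw [diagPart_apply, diagPart_apply]
    linarith

/-! ### Positivity of quadratic forms in block form -/

section BlockForm

variable {M : Sym3 →L[ℝ] Sym3} {c : Fin 3 → Fin 3 → ℝ}

lemma inner_sym_apply (X Y : Sym3) :
    inner ℝ X Y = inner ℝ (diagPart X) (diagPart Y)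
      + ∑ i, ∑ j, if i = j then 0 else (X : Mat3) i j * (Y : Mat3) i j := by
  rw [inner_sym_eq]
  simp only [Matrix.trace, Matrix.diag, Matrix.mul_apply, PiLp.inner_apply, diagPart_apply,
    RCLike.inner_apply, conj_trivial, Fin.sum_univ_three]
  rw [sym3_apply_comm Y 1 0, sym3_apply_comm Y 2 0, sym3_apply_comm Y 2 1]
  simp
  ring

lemma IsBlockForm.inner_eq (h : IsBlockForm M c) (H : Sym3) :
    inner ℝ (M H) H = inner ℝ (diagPart (M (diagSym (diagPart H)))) (diagPart H)
      + ∑ i, ∑ j, if i = j then 0 else c i j * (H : Mat3) i j ^ 2 := by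
  rw [inner_sym_apply, ← h.diag]
  congr 1
  refine Finset.sum_congr rfl fun i _ => Finset.sum_congr rfl fun j _ => ?_
  split_ifs with hij
  · rfl
  · rw [h.off H i j hij]; ring

@[simp] lemma diagPart_diagSym (d : E3) : diagPart (diagSym d) = d := by
  ext i
  simp

lemma IsBlockForm.map_diagSym (h : IsBlockForm M c) (d : E3) :
    M (diagSym d) = diagSym (diagPart (M (diagSym d))) := by
  apply Subtype.ext
  ext i j
  by_cases hij : i = j
  · subst hij; simp
  · rw [h.off _ i j hij, diagSym_coe, diagSym_coe, Matrix.diagonal_apply_ne _ hij,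
      Matrix.diagonal_apply_ne _ hij, mul_zero]

lemma offSym_ne_zero {i j : Fin 3} (hij : i ≠ j) : offSym i j ≠ 0 := fun h => by
  have := offSym_apply_self hij
  rw [h] at this
  simp at this

lemma IsBlockForm.symm (h : IsBlockForm M c) {i j : Fin 3} (hij : i ≠ j) : c i j = c j i := by
  have h1 := h.off (offSym i j) i j hij
  have h2 := h.off (offSym i j) j i hij.symm
  rw [sym3_apply_comm _ j i, sym3_apply_comm (offSym i j) j i, h1, offSym_apply_self hij] at h2
  simpa using h2

/-- The form is an orthogonal sum of the diagonal block and the terms `c i j * H i j ^ 2`; testing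
on `diagSym d` and `offSym i j` isolates the summands. -/
lemma IsBlockForm.posDef_iff (h : IsBlockForm M c) :
    (∀ H : Sym3, H ≠ 0 → 0 < inner ℝ (M H) H) ↔
      (∀ d : E3, d ≠ 0 → 0 < inner ℝ (diagPart (M (diagSym d))) d) ∧
        ∀ i j, i ≠ j → 0 < c i j := by
  constructor
  · intro hp
    constructor
    · intro d hd
      have h0 : diagSym d ≠ 0 := fun h0 => hd (by rw [← diagPart_diagSym d, h0, map_zero])
      have := hp _ h0
      rw [h.inner_eq, diagPart_diagSym] at this
      convert this using 1
      rw [left_eq_add]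
      refine Finset.sum_eq_zero fun i _ => Finset.sum_eq_zero fun j _ => ?_
      split_ifs with hij
      · rfl
      · rw [diagSym_coe, Matrix.diagonal_apply_ne _ hij]; ring
    · intro i j hij
      have := hp _ (offSym_ne_zero hij)
      have hd : diagPart (offSym i j) = 0 := by
        ext a
        have : ¬ (i = a ∧ j = a) := fun h => hij (h.1.trans h.2.symm)
        have : ¬ (j = a ∧ i = a) := fun h => hij (h.2.trans h.1.symm)
        simp [offSym_coe, *]
      have hs : M (offSym i j) = c i j • offSym i j := by
        apply Subtype.ext
        ext a b
        by_cases hab : a = b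
        · subst hab
          have h1 := congrArg (fun v : E3 => v a) (h.diag (offSym i j))
          have h2 := congrArg (fun v : E3 => v a) hd
          rw [hd] at h1
          simp at h1 h2
          simp [h1, h2]
        · rw [h.off _ a b hab, Submodule.coe_smul, Matrix.smul_apply, smul_eq_mul]
          by_cases h1 : i = a ∧ j = b
          · rw [h1.1, h1.2]
          · by_cases h2 : j = a ∧ i = b
            · rw [← h2.1, ← h2.2, h.symm hij]
            · simp [offSym_coe, h1, h2]
      have e : inner ℝ (c i j • offSym i j) (offSym i j)
          = c i j * inner ℝ (offSym i j) (offSym i j) := by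
        exact @real_inner_smul_left Sym3 _ _ (offSym i j) (offSym i j) (c i j)
      rw [hs, e] at this
      have h0 : 0 ≤ inner ℝ (offSym i j) (offSym i j) :=
        @real_inner_self_nonneg Sym3 _ _ (offSym i j)
      exact pos_of_mul_pos_left this h0
  · rintro ⟨h1, h2⟩ H hH
    rw [h.inner_eq]
    have hn : ∀ i j, 0 ≤ if i = j then 0 else c i j * (H : Mat3) i j ^ 2 := by
      intro i j
      split_ifs with hij
      · exact le_rfl
      · exact mul_nonneg (h2 i j hij).le (sq_nonneg _)
    have hs : 0 ≤ ∑ i, ∑ j, if i = j then 0 else c i j * (H : Mat3) i j ^ 2 :=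
      Finset.sum_nonneg fun i _ => Finset.sum_nonneg fun j _ => hn i j
    by_cases hd : diagPart H = 0
    · obtain ⟨i, j, hne⟩ : ∃ i j, (H : Mat3) i j ≠ 0 := by
        by_contra! hz
        exact hH (Subtype.ext (Matrix.ext hz))
      have hij : i ≠ j := by
        rintro rfl
        exact hne (congrArg (fun v : E3 => v i) hd)
      rw [hd, map_zero, map_zero, map_zero, inner_zero_left, zero_add]
      refine Finset.sum_pos' (fun i _ => Finset.sum_nonneg fun j _ => hn i j)
        ⟨i, Finset.mem_univ _, Finset.sum_pos' (fun j _ => hn i j) ⟨j, Finset.mem_univ _, ?_⟩⟩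
      rw [if_neg hij]
      exact mul_pos (h2 i j hij) (by positivity)
    · exact add_pos_of_pos_of_nonneg (h1 _ hd) hs

end BlockForm

/-! ### The derivative of an equivariant map at a diagonal tensor -/

section Equivariant

variable {T : Sym3 → Sym3}

lemma OrthEquivariant.isBlockForm_fderiv (hE : OrthEquivariant T) (hT : Differentiable ℝ T)
    (x : E3) :
    ∃ c, IsBlockForm (fderiv ℝ T (diagSym x)) c :=
  ⟨_, isBlockForm_of_commute_reflMat fun k H => by
    have := hE.fderiv_congrSym hT (X := diagSym x) (reflMat_mem k) H
    rwa [congrSym_reflMat_diagSym] at this⟩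

lemma OrthEquivariant.map_diagSym (hE : OrthEquivariant T) (x : E3) :
    T (diagSym x) = diagSym (diagPart (T (diagSym x))) := by
  have h : ∀ k, congrSym (reflMat k) (T (diagSym x)) = T (diagSym x) := fun k => by
    rw [← hE _ (reflMat_mem k), congrSym_reflMat_diagSym]
  have := add_sum_congrSym_reflMat (T (diagSym x))
  simp only [h, Fin.sum_univ_three] at this
  have h4 : T (diagSym x) + (T (diagSym x) + T (diagSym x) + T (diagSym x))
    = (4 : ℝ) • T (diagSym x) := by module
  rw [h4] at this
  exact smul_right_injective _ (by norm_num : (4 : ℝ) ≠ 0) this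

/-- The off-diagonal coefficients of the derivative at distinct eigenvalues. -/
lemma OrthEquivariant.coeff_mul_sub (hE : OrthEquivariant T) (hT : Differentiable ℝ T)
    {x : E3} {c : Fin 3 → Fin 3 → ℝ} (hc : IsBlockForm (fderiv ℝ T (diagSym x)) c)
    {i j : Fin 3} (hij : i ≠ j) :
    c i j * (x i - x j) = (T (diagSym x) : Mat3) i i - (T (diagSym x) : Mat3) j j := by
  have h := hE.fderiv_lieSym (hT (diagSym x)) (rotGen_transpose i j)
  rw [hE.map_diagSym x, lieSym_rotGen_diagSym, lieSym_rotGen_diagSym, map_smul] at h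
  have h' := congrFun (congrFun (congrArg Subtype.val h) i) j
  simp only [Submodule.coe_smul, Matrix.smul_apply, smul_eq_mul, hc.off _ i j hij,
    offSym_apply_self hij, diagPart_apply] at h'
  linarith

/-- The off-diagonal coefficients of the derivative at coinciding eigenvalues. -/
lemma OrthEquivariant.two_mul_coeff (hE : OrthEquivariant T) (hT : Differentiable ℝ T)
    {x : E3} {c : Fin 3 → Fin 3 → ℝ} (hc : IsBlockForm (fderiv ℝ T (diagSym x)) c)
    {i j : Fin 3} (hij : i ≠ j) (hx : x i = x j) :
    2 * c i j = inner ℝ (diagPart (fderiv ℝ T (diagSym x)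
      (diagSym (EuclideanSpace.single i 1 - EuclideanSpace.single j 1))))
      (EuclideanSpace.single i 1 - EuclideanSpace.single j 1 : E3) := by
  set M := fderiv ℝ T (diagSym x) with hM
  set e : E3 := EuclideanSpace.single i 1 - EuclideanSpace.single j 1 with he
  have h0 : rotGen i j * Matrix.diagonal x = Matrix.diagonal x * rotGen i j := by
    have := congrArg Subtype.val (lieSym_rotGen_diagSym i j x)
    rw [hx, sub_self, zero_smul, lieSym_coe, rotGen_transpose, Matrix.mul_neg, diagSym_coe,
      ← sub_eq_add_neg] at this
    exact sub_eq_zero.1 this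
  -- With equal eigenvalues the rotations of the `(i, j)` plane fix `diagSym x`, so the derivative
  -- `M` itself commutes with them. The infinitesimal identity is then applied to `M` at `diagSym
  -- e`, whose entries `1` and `-1` are distinct.
  have h1 : ∀ t : ℝ, congrSym (NormedSpace.exp (t • rotGen i j)) (diagSym x) = diagSym x := by
    intro t
    have hq := exp_smul_mem_orthogonal (rotGen_transpose i j) t
    have hcomm : Commute (NormedSpace.exp (t • rotGen i j)) (Matrix.diagonal x) :=
      (Commute.smul_left (show Commute (rotGen i j) (Matrix.diagonal x) from h0) t).exp_left
    apply Subtype.ext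
    rw [congrSym_coe, diagSym_coe, hcomm.eq, Matrix.mul_assoc,
      self_mul_transpose_of_orthogonal hq, Matrix.mul_one]
  have h2 := _root_.fderiv_lieSym (T := M) (X := diagSym e) (W := rotGen i j) M.differentiableAt
    fun t => by
      have := hE.fderiv_congrSym hT (X := diagSym x)
        (exp_smul_mem_orthogonal (rotGen_transpose i j) t) (diagSym e)
      rwa [h1] at this
  rw [ContinuousLinearMap.fderiv, hc.map_diagSym, lieSym_rotGen_diagSym, lieSym_rotGen_diagSym,
    map_smul] at h2
  have h' := congrFun (congrFun (congrArg Subtype.val h2) i) j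
  have ei : e i = 1 := by simp [he, hij]
  have ej : e j = -1 := by simp [he, hij.symm]
  simp only [Submodule.coe_smul, Matrix.smul_apply, smul_eq_mul, hc.off _ i j hij,
    offSym_apply_self hij, ei, ej] at h'
  rw [he, inner_sub_right, EuclideanSpace.inner_single_right, EuclideanSpace.inner_single_right]
  simp only [conj_trivial, one_mul]
  rw [← he]
  linarith

end Equivariant

/-! ### The derivative of the exponential and of the logarithm -/

lemma differentiable_expSym : Differentiable ℝ expSym := contDiff_expSym.differentiable one_ne_zero

lemma fderiv_expSym_diagSym_apply (x h : E3) (i : Fin 3) :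
    (fderiv ℝ expSym (diagSym x) (diagSym h) : Mat3) i i = Real.exp (x i) * h i := by
  have h1 : HasDerivAt (fun s : ℝ => diagSym (x + s • h)) (diagSym h) 0 := by
    have : HasDerivAt (fun s : ℝ => x + s • h) h 0 := by
      simpa using ((hasDerivAt_id (0 : ℝ)).smul_const h).const_add x
    exact diagSym.hasFDerivAt.comp_hasDerivAt (0 : ℝ) this
  have h2 : HasFDerivAt expSym (fderiv ℝ expSym (diagSym x)) (diagSym (x + (0 : ℝ) • h)) := by
    rw [zero_smul, add_zero]
    exact (differentiable_expSym _).hasFDerivAt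
  have h3 := ((EuclideanSpace.proj i : E3 →L[ℝ] ℝ).comp diagPart).hasFDerivAt.comp_hasDerivAt
    (0 : ℝ) (h2.comp_hasDerivAt (0 : ℝ) h1)
  have h4 : HasDerivAt (fun s : ℝ => Real.exp (x i + s * h i)) (Real.exp (x i) * h i) 0 := by
    simpa using (((hasDerivAt_id (0 : ℝ)).mul_const (h i)).const_add (x i)).exp
  refine HasDerivAt.unique (HasDerivAt.congr_of_eventuallyEq h3 ?_) h4
  refine Filter.Eventually.of_forall fun s => ?_
  change _ = (expSym (diagSym (x + s • h)) : Mat3) i i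
  simp only [expSym_diagSym, diagSym_coe, Matrix.diagonal_apply_eq, PiLp.add_apply,
    PiLp.smul_apply, smul_eq_mul]

/-- These are divided differences of the increasing function `Real.exp`, or its derivative at equal
eigenvalues. -/
lemma exp_coeff_pos {x : E3} {c : Fin 3 → Fin 3 → ℝ}
    (hc : IsBlockForm (fderiv ℝ expSym (diagSym x)) c) {i j : Fin 3} (hij : i ≠ j) :
    0 < c i j := by
  rcases eq_or_ne (x i) (x j) with hx | hx
  · have h := orthEquivariant_expSym.two_mul_coeff differentiable_expSym hc hij hx
    rw [inner_sub_right, EuclideanSpace.inner_single_right,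
      EuclideanSpace.inner_single_right] at h
    simp [fderiv_expSym_diagSym_apply, hij, hij.symm] at h
    have := Real.exp_pos (x i)
    have := Real.exp_pos (x j)
    linarith
  · have h := orthEquivariant_expSym.coeff_mul_sub differentiable_expSym hc hij
    simp only [expSym_diagSym, diagSym_coe, Matrix.diagonal_apply_eq] at h
    rcases hx.lt_or_gt with hlt | hlt
    · have := Real.exp_lt_exp.2 hlt
      nlinarith
    · have := Real.exp_lt_exp.2 hlt
      nlinarith

lemma fderiv_expSym_diagSym_injective (x : E3) :
    Function.Injective (fderiv ℝ expSym (diagSym x)) := by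
  obtain ⟨c, hc⟩ := orthEquivariant_expSym.isBlockForm_fderiv differentiable_expSym x
  refine (injective_iff_map_eq_zero _).2 fun H hH => ?_
  apply Subtype.ext
  ext i j
  by_cases hij : i = j
  · subst hij
    have h := congrArg (fun v : E3 => v i) (hc.diag H)
    simp only [diagPart_apply, fderiv_expSym_diagSym_apply, hH] at h
    simpa using h
  · have h := hc.off H i j hij
    rw [hH] at h
    simpa [(exp_coeff_pos hc hij).ne'] using h

lemma fderiv_expSym_injective (X : Sym3) : Function.Injective (fderiv ℝ expSym X) := by
  obtain ⟨Q, hQ, x, rfl⟩ := exists_congrSym_diagSym X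
  refine (injective_iff_map_eq_zero _).2 fun H hH => ?_
  rw [← congrSym_congrSym_transpose hQ H,
    orthEquivariant_expSym.fderiv_congrSym differentiable_expSym hQ] at hH
  have h1 := congrArg (congrSym Qᵀ) hH
  rw [congrSym_transpose_congrSym hQ, map_zero] at h1
  have h2 := (injective_iff_map_eq_zero _).1 (fderiv_expSym_diagSym_injective x) _ h1
  rw [← congrSym_congrSym_transpose hQ H, h2, map_zero]

/-- The derivative of the exponential on the symmetric tensors, as an isomorphism. -/
noncomputable def expDeriv (X : Sym3) : Sym3 ≃L[ℝ] Sym3 :=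
  (LinearEquiv.ofInjectiveEndo (fderiv ℝ expSym X).toLinearMap
    (fderiv_expSym_injective X)).toContinuousLinearEquiv

lemma hasStrictFDerivAt_expSym (X : Sym3) :
    HasStrictFDerivAt expSym (expDeriv X : Sym3 →L[ℝ] Sym3) X :=
  contDiff_expSym.contDiffAt.hasStrictFDerivAt one_ne_zero

/-- Inverse function theorem: `matLog` is a global left inverse of `expSym`, so it agrees with the
local inverse near `expSym X`. -/
lemma hasFDerivAt_matLog (X : Sym3) :
    HasFDerivAt (fun Y : Sym3 => matLog Y) ((expDeriv X).symm : Sym3 →L[ℝ] Sym3) (expSym X) := by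
  have h := hasStrictFDerivAt_expSym X
  refine (h.to_localInverse.hasFDerivAt).congr_of_eventuallyEq ?_
  filter_upwards [h.eventually_right_inverse] with Y hY
  conv_lhs => rw [← hY]
  rw [matLog_expSym]

/-! ### Positive operators and monotone maps on Euclidean spaces -/

section Operators

variable {H : Type*} [NormedAddCommGroup H] [InnerProductSpace ℝ H] [CompleteSpace H]

/-- The skew part of an operator contributes nothing to its quadratic form. -/
lemma isSymPosDef_symPart_iff (A : H →L[ℝ] H) :
    IsSymPosDef (symPart A) ↔ ∀ h : H, h ≠ 0 → 0 < inner ℝ (A h) h := by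
  have e : ∀ h : H, inner ℝ (symPart A h) h = inner ℝ (A h) h := by
    intro h
    simp only [symPart, _root_.smul_apply, _root_.add_apply,
      real_inner_smul_left, inner_add_left, ContinuousLinearMap.adjoint_inner_left]
    rw [real_inner_comm (A h) h]
    ring
  have hs : IsSelfAdjoint (symPart A) := by
    rw [IsSelfAdjoint, symPart, star_smul, star_add, ← ContinuousLinearMap.star_eq_adjoint,
      star_star, add_comm]
    simp
  simp only [IsSymPosDef, e]
  exact ⟨fun h => h.2, fun h => ⟨hs, h⟩⟩

end Operators

/-- Along the segment from `y` to `x`, the pairing with `x - y` has positive derivative. -/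
lemma StronglyMonotone.inner_sub_pos {H : Type*} [NormedAddCommGroup H] [InnerProductSpace ℝ H]
    {f : H → H} (hf : StronglyMonotone f) {x y : H}
    (hxy : x ≠ y) : 0 < inner ℝ (f x - f y) (x - y) := by
  have hd : ∀ s : ℝ, HasDerivAt (fun s : ℝ => inner ℝ (f (y + s • (x - y))) (x - y))
      (inner ℝ (fderiv ℝ f (y + s • (x - y)) (x - y)) (x - y)) s := by
    intro s
    have h1 : HasDerivAt (fun s : ℝ => y + s • (x - y)) (x - y) s := by
      simpa using ((hasDerivAt_id s).smul_const (x - y)).const_add y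
    have h2 := (hf.1 (y + s • (x - y))).hasFDerivAt.comp_hasDerivAt s h1
    simpa using h2.inner ℝ (hasDerivAt_const s (x - y))
  have hm : StrictMono fun s : ℝ => inner ℝ (f (y + s • (x - y))) (x - y) :=
    strictMono_of_deriv_pos fun s => by
      rw [(hd s).deriv]
      exact hf.2 _ _ (sub_ne_zero.2 hxy)
  have := hm (zero_lt_one' ℝ)
  simp only [zero_smul, add_zero, one_smul, add_sub_cancel] at this
  rw [inner_sub_left]
  linarith

/-! ### Kinematics -/

lemma posDef_mul_transpose {F : Mat3} (hF : 0 < F.det) : (F * Fᵀ).PosDef := by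
  have hu : IsUnit F := (Matrix.isUnit_iff_isUnit_det _).2 hF.ne'.isUnit
  have := Matrix.PosDef.mul_conjTranspose_self F (Matrix.vecMul_injective_iff_isUnit.2 hu)
  rwa [conjTranspose_eq_transpose_of_trivial] at this

/-- The linear map sending the strain rate `D` to the corotational rate of `log B` at
`B = exp X`. -/
noncomputable def logRate (X : Sym3) : Sym3 →L[ℝ] Sym3 :=
  ((expDeriv X).symm : Sym3 →L[ℝ] Sym3).comp (lieSym (expSym X : Mat3))

lemma expDeriv_logRate (X H : Sym3) :
    fderiv ℝ expSym X (logRate X H) = lieSym (expSym X : Mat3) H :=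
  (expDeriv X).apply_symm_apply _

lemma lieSym_comm (X Y : Sym3) : lieSym (X : Mat3) Y = lieSym (Y : Mat3) X := by
  apply Subtype.ext
  rw [lieSym_coe, lieSym_coe, sym3_transpose, sym3_transpose, add_comm]

/-- Separates strain rate from vorticity: the `W` part passes through the derivatives of the
logarithm and of `T` by equivariance of `expSym` and `T`. -/
lemma OrthEquivariant.fderiv_expDeriv_symm {T : Sym3 → Sym3} (hE : OrthEquivariant T)
    (hT : Differentiable ℝ T) (X D : Sym3) {W : Mat3} (hW : Wᵀ = -W) :
    fderiv ℝ T X ((expDeriv X).symm (lieSym ((D : Mat3) + W) (expSym X)))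
      = fderiv ℝ T X (logRate X D) + lieSym W (T X) := by
  have h1 : expDeriv X (lieSym W X) = lieSym W (expSym X) :=
    orthEquivariant_expSym.fderiv_lieSym (differentiable_expSym X) hW
  rw [lieSym_add, map_add, ← h1, ContinuousLinearEquiv.symm_apply_apply, map_add,
    hE.fderiv_lieSym (hT X) hW, lieSym_comm]
  rfl

namespace Motion

variable (m : Motion) {x : E3} (t : ℝ)

lemma hasDerivAt_F (hx : x ∈ m.body) : HasDerivAt (m.F x) (m.L x t * m.F x t) t := by
  have h : IsUnit (m.F x t).det := (m.det_pos t x hx).ne'.isUnit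
  have h1 : m.L x t * m.F x t = deriv (m.F x) t := by
    rw [L, Matrix.mul_assoc, Matrix.nonsing_inv_mul _ h, Matrix.mul_one]
  rw [h1]
  exact (m.differentiable_gradient x hx t).hasDerivAt

lemma symProj_B_coe (x : E3) (t : ℝ) : (symProj (m.B x t) : Mat3) = m.B x t :=
  congrArg Subtype.val (symProj_coe ⟨m.B x t, by
    change (m.F x t * (m.F x t)ᵀ)ᵀ = _
    rw [Matrix.transpose_mul, Matrix.transpose_transpose]; rfl⟩)

lemma hasDerivAt_symProj_B (hx : x ∈ m.body) :
    HasDerivAt (fun s => symProj (m.B x s)) (lieSym (m.L x t) (symProj (m.B x t))) t := by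
  have h1 := m.hasDerivAt_F t hx
  have h2 : HasDerivAt (fun s => (m.F x s)ᵀ) (m.L x t * m.F x t)ᵀ t :=
    (LinearMap.toContinuousLinearMap
      (Matrix.transposeLinearEquiv (Fin 3) (Fin 3) ℝ ℝ).toLinearMap).hasFDerivAt.comp_hasDerivAt t h1
  have h3 := symProj.hasFDerivAt.comp_hasDerivAt t (h1.mul h2)
  have e : lieSym (m.L x t) (symProj (m.B x t))
      = symProj (m.L x t * m.F x t * (m.F x t)ᵀ + m.F x t * (m.L x t * m.F x t)ᵀ) := by
    rw [← symProj_coe (lieSym _ _), lieSym_coe, symProj_B_coe, B, Matrix.transpose_mul]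
    simp only [Matrix.mul_assoc]
  rw [e]
  exact h3

/-- The strain rate as a symmetric tensor. -/
noncomputable def strainRate (x : E3) (t : ℝ) : Sym3 := symProj (m.L x t)

lemma strainRate_coe (x : E3) (t : ℝ) : (m.strainRate x t : Mat3) = m.D x t := rfl

lemma W_transpose (x : E3) (t : ℝ) : (m.W x t)ᵀ = -m.W x t := by
  simp [W, ← smul_neg]

lemma D_add_W (x : E3) (t : ℝ) : m.D x t + m.W x t = m.L x t := by
  rw [D, W]
  module

/-- The Zaremba-Jaumann rate of an isotropic stress as a function of the strain rate. -/
lemma zjRate_eq {sigHat : Sym3 → Sym3} (hdiff : Differentiable ℝ sigHat)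
    (hE : OrthEquivariant sigHat) (hx : x ∈ m.body) :
    m.zjRate sigHat x t = (fderiv ℝ sigHat (matLog (m.B x t))
      (logRate (matLog (m.B x t)) (m.strainRate x t)) : Mat3) := by
  set X := matLog (m.B x t) with hX
  have hB : expSym X = symProj (m.B x t) :=
    Subtype.ext ((expSym_matLog (posDef_mul_transpose (m.det_pos t x hx))).trans
      (m.symProj_B_coe x t).symm)
  have h1 : HasDerivAt (fun s => symProj (m.B x s)) (lieSym (m.L x t) (expSym X)) t := by
    rw [hB]; exact m.hasDerivAt_symProj_B t hx
  have h2 : HasFDerivAt (fun Y : Sym3 => matLog Y) ((expDeriv X).symm : Sym3 →L[ℝ] Sym3)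
      (symProj (m.B x t)) := by
    rw [← hB]; exact hasFDerivAt_matLog X
  have h3 := h2.comp_hasDerivAt t h1
  have h4 : HasFDerivAt sigHat (fderiv ℝ sigHat X)
      (((fun Y : Sym3 => matLog Y) ∘ fun s => symProj (m.B x s)) t) := by
    rw [Function.comp_apply, m.symProj_B_coe]
    exact (hdiff X).hasFDerivAt
  have h5 := Sym3.subtypeL.hasFDerivAt.comp_hasDerivAt t (h4.comp_hasDerivAt t h3)
  have e : (fun s => cauchyStress sigHat (m.B x s)) = Sym3.subtypeL ∘ sigHat ∘
      (fun Y : Sym3 => matLog Y) ∘ fun s => symProj (m.B x s) := by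
    funext s
    simp only [Function.comp_apply, m.symProj_B_coe]
    rfl
  have h6 : deriv (fun s => cauchyStress sigHat (m.B x s)) t
      = (fderiv ℝ sigHat X ((expDeriv X).symm (lieSym (m.L x t) (expSym X))) : Mat3) := by
    rw [e]
    exact h5.deriv
  rw [zjRate, h6, ← m.D_add_W, ← m.strainRate_coe,
    hE.fderiv_expDeriv_symm hdiff X (m.strainRate x t) (m.W_transpose x t),
    Submodule.coe_add, lieSym_coe, m.W_transpose, cauchyStress, ← hX, Matrix.mul_neg]
  abel

end Motion

/-! ### Homogeneous motions with prescribed deformation gradient and strain rate -/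

lemma jacobianMatrix_toEuclideanCLM (A : Mat3) (x : E3) :
    jacobianMatrix (Matrix.toEuclideanCLM (n := Fin 3) (𝕜 := ℝ) A) x = A := by
  ext i j
  rw [jacobianMatrix, Matrix.of_apply, ContinuousLinearMap.fderiv]
  have : (EuclideanSpace.single j (1 : ℝ) : E3) = WithLp.toLp 2 (Pi.single j 1) := rfl
  rw [this, Matrix.toEuclideanCLM_toLp]
  simp

lemma injective_toEuclideanCLM {A : Mat3} (hA : 0 < A.det) :
    Function.Injective (Matrix.toEuclideanCLM (n := Fin 3) (𝕜 := ℝ) A) := by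
  refine Function.LeftInverse.injective
    (g := Matrix.toEuclideanCLM (n := Fin 3) (𝕜 := ℝ) A⁻¹) fun v => ?_
  rw [← mul_apply_eq_comp, ← map_mul, Matrix.nonsing_inv_mul _ hA.ne'.isUnit,
    map_one, one_apply_eq_self]

lemma det_exp_smul_mul_pos {F₀ : Mat3} (hF : 0 < F₀.det) (D : Sym3) (t : ℝ) :
    0 < (NormedSpace.exp (t • (D : Mat3)) * F₀).det := by
  rw [Matrix.det_mul]
  exact mul_pos (expSym_posDef (t • D)).det_pos hF

/-- The homogeneous motion with deformation gradient `exp (t D) F₀`. -/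
noncomputable def homogeneousMotion (F₀ : Mat3) (hF : 0 < F₀.det) (D : Sym3) : Motion where
  body := Set.univ
  isOpen_body := isOpen_univ
  map t := Matrix.toEuclideanCLM (n := Fin 3) (𝕜 := ℝ) (NormedSpace.exp (t • (D : Mat3)) * F₀)
  contDiffOn_map t := (ContinuousLinearMap.contDiff _).contDiffOn
  injOn_map t := (injective_toEuclideanCLM (det_exp_smul_mul_pos hF D t)).injOn
  det_pos t x _ := by
    rw [jacobianMatrix_toEuclideanCLM]
    exact det_exp_smul_mul_pos hF D t
  differentiable_gradient x _ := by
    simp only [jacobianMatrix_toEuclideanCLM]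
    exact fun t => ((hasDerivAt_exp_smul_const (𝕂 := ℝ) (D : Mat3) t).mul_const
      F₀).differentiableAt

section

variable (F₀ : Mat3) (hF : 0 < F₀.det) (D : Sym3)

lemma homogeneousMotion_F (x : E3) :
    (homogeneousMotion F₀ hF D).F x = fun t => NormedSpace.exp (t • (D : Mat3)) * F₀ := by
  funext t
  exact jacobianMatrix_toEuclideanCLM _ x

lemma homogeneousMotion_F_zero (x : E3) : (homogeneousMotion F₀ hF D).F x 0 = F₀ := by
  simp [homogeneousMotion_F]

lemma homogeneousMotion_D_zero (x : E3) : (homogeneousMotion F₀ hF D).D x 0 = D := by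
  have h1 : deriv ((homogeneousMotion F₀ hF D).F x) 0 = D * F₀ := by
    rw [homogeneousMotion_F]
    exact ((hasDerivAt_exp_smul_zero (D : Mat3)).mul_const F₀).deriv
  have h2 : (homogeneousMotion F₀ hF D).L x 0 = D := by
    rw [Motion.L, h1, homogeneousMotion_F_zero, Matrix.mul_assoc,
      Matrix.mul_nonsing_inv _ hF.ne'.isUnit, Matrix.mul_one]
  rw [← Motion.strainRate_coe, Motion.strainRate, h2, symProj_coe]

end

/-- CSP at a deformation gradient as positivity of a quadratic form in the strain rate. -/
lemma cspAt_iff {sigHat : Sym3 → Sym3} (hdiff : Differentiable ℝ sigHat)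
    (hE : OrthEquivariant sigHat) {F : Mat3} (hF : 0 < F.det) :
    CSPAt sigHat F ↔ ∀ D : Sym3, D ≠ 0 → 0 < inner ℝ
      (((fderiv ℝ sigHat (matLog (F * Fᵀ))).comp (logRate (matLog (F * Fᵀ)))) D) D := by
  constructor
  · intro h D hD
    have h0 : (homogeneousMotion F hF D).D 0 0 ≠ 0 := by
      rw [homogeneousMotion_D_zero]
      exact fun h => hD (Subtype.ext h)
    have := h (homogeneousMotion F hF D) 0 0 (Set.mem_univ _)
      (homogeneousMotion_F_zero F hF D 0) h0
    rw [Motion.zjRate_eq _ 0 hdiff hE (Set.mem_univ _), Motion.B, homogeneousMotion_F_zero] at this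
    have hs : (homogeneousMotion F hF D).strainRate 0 0 = D :=
      Subtype.ext (homogeneousMotion_D_zero F hF D 0)
    rw [← Motion.strainRate_coe, hs] at this
    exact this
  · intro h m x t hx hmF hD
    have hs : m.strainRate x t ≠ 0 := fun h0 => hD (by rw [← m.strainRate_coe, h0]; rfl)
    have := h _ hs
    rw [m.zjRate_eq t hdiff hE hx, Motion.B, hmF]
    exact this

/-! ### Comparison of the quadratic forms -/

lemma forall_inner_pos_congrSym_iff {M N : Sym3 →L[ℝ] Sym3} {Q : Mat3}
    (hQ : Q ∈ Matrix.orthogonalGroup (Fin 3) ℝ)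
    (h : ∀ H, N (congrSym Q H) = congrSym Q (M H)) :
    (∀ H : Sym3, H ≠ 0 → 0 < inner ℝ (N H) H) ↔ ∀ H : Sym3, H ≠ 0 → 0 < inner ℝ (M H) H := by
  constructor
  · intro hN H hH
    rw [← inner_congrSym hQ, ← h]
    refine hN _ fun h0 => hH ?_
    rw [← congrSym_transpose_congrSym hQ H, h0, map_zero]
  · intro hM H hH
    rw [← congrSym_congrSym_transpose hQ H, h, inner_congrSym hQ]
    refine hM _ fun h0 => hH ?_
    rw [← congrSym_congrSym_transpose hQ H, h0, map_zero]

/-- The injective derivative of `expSym` reduces the claim to the explicit map `H ↦ B H + H B`. -/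
lemma logRate_congrSym {Q : Mat3} (hQ : Q ∈ Matrix.orthogonalGroup (Fin 3) ℝ) (X H : Sym3) :
    logRate (congrSym Q X) (congrSym Q H) = congrSym Q (logRate X H) := by
  apply fderiv_expSym_injective (congrSym Q X)
  rw [expDeriv_logRate, orthEquivariant_expSym.fderiv_congrSym differentiable_expSym hQ,
    expDeriv_logRate, expSym_congrSym hQ]
  apply Subtype.ext
  have h := transpose_mul_self_of_orthogonal hQ
  have h' : ∀ A : Mat3, Qᵀ * (Q * A) = A := fun A => by
    rw [← Matrix.mul_assoc, h, Matrix.one_mul]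
  simp only [lieSym_coe, congrSym_coe, Matrix.transpose_mul, Matrix.transpose_transpose,
    Matrix.mul_add, Matrix.add_mul, Matrix.mul_assoc, h']

lemma lieSym_diagSym_apply (b : E3) (H : Sym3) (i j : Fin 3) :
    (lieSym (diagSym b : Mat3) H : Mat3) i j = (b i + b j) * (H : Mat3) i j := by
  rw [lieSym_coe, sym3_transpose, diagSym_coe, Matrix.add_apply, Matrix.diagonal_mul,
    Matrix.mul_diagonal]
  ring

/-- In an eigenbasis of `X`, the map `logRate X` multiplies the entries by positive factors. -/
lemma exists_logRate_diagSym (x : E3) :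
    ∃ φ : Fin 3 → Fin 3 → ℝ, (∀ i j, i ≠ j → 0 < φ i j) ∧
      (∀ H : Sym3, ∀ i j, i ≠ j →
        (logRate (diagSym x) H : Mat3) i j = φ i j * (H : Mat3) i j) ∧
      ∀ H : Sym3, diagPart (logRate (diagSym x) H) = (2 : ℝ) • diagPart H := by
  obtain ⟨g, hg⟩ := orthEquivariant_expSym.isBlockForm_fderiv differentiable_expSym x
  -- Off the diagonal, `H ↦ B H + H B` multiplies by the sum of exponentials and the derivative of
  -- `expSym` by `g i j`; on the diagonal the quotient is `2 exp / exp = 2`.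
  refine ⟨fun i j => (Real.exp (x i) + Real.exp (x j)) / g i j, fun i j hij =>
    div_pos (by positivity) (exp_coeff_pos hg hij), fun H i j hij => ?_, fun H => ?_⟩
  · have h := hg.off (logRate (diagSym x) H) i j hij
    rw [expDeriv_logRate, expSym_diagSym, lieSym_diagSym_apply] at h
    have hp := (exp_coeff_pos hg hij).ne'
    simp only at h
    rw [div_mul_eq_mul_div, h]
    field_simp
  · ext i
    have h := congrArg (fun v : E3 => v i) (hg.diag (logRate (diagSym x) H))
    simp only [expDeriv_logRate, expSym_diagSym, diagPart_apply, lieSym_diagSym_apply,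
      fderiv_expSym_diagSym_apply] at h
    have := Real.exp_pos (x i)
    simp only [diagPart_apply, PiLp.smul_apply, smul_eq_mul]
    have h' : Real.exp (x i) * (logRate (diagSym x) H : Mat3) i i
        = Real.exp (x i) * (2 * (H : Mat3) i i) := by linarith
    exact mul_left_cancel₀ this.ne' h'

lemma forall_inner_pos_comp_logRate_diagSym_iff {M : Sym3 →L[ℝ] Sym3} {c : Fin 3 → Fin 3 → ℝ}
    (hM : IsBlockForm M c) (x : E3) :
    (∀ H : Sym3, H ≠ 0 → 0 < inner ℝ ((M.comp (logRate (diagSym x))) H) H) ↔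
      ∀ H : Sym3, H ≠ 0 → 0 < inner ℝ (M H) H := by
  obtain ⟨φ, hφ, hoff, hdiag⟩ := exists_logRate_diagSym x
  have hd : ∀ H, diagPart (M (logRate (diagSym x) H))
      = (2 : ℝ) • diagPart (M (diagSym (diagPart H))) := fun H => by
    rw [hM.diag, hdiag, map_smul, map_smul, map_smul]
  have hN : IsBlockForm (M.comp (logRate (diagSym x))) fun i j => c i j * φ i j :=
    { off := fun H i j hij => by
        rw [ContinuousLinearMap.comp_apply, hM.off _ i j hij, hoff H i j hij, mul_assoc]
      diag := fun H => by
        rw [ContinuousLinearMap.comp_apply, ContinuousLinearMap.comp_apply, hd, hd,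
          diagPart_diagSym] }
  rw [hN.posDef_iff, hM.posDef_iff]
  refine and_congr (forall₂_congr fun d _ => ?_) (forall₃_congr fun i j hij => ?_)
  · rw [ContinuousLinearMap.comp_apply, hd, diagPart_diagSym, real_inner_smul_left]
    exact mul_pos_iff_of_pos_left two_pos
  · exact mul_pos_iff_of_pos_right (hφ i j hij)

/-! ### Equivalences for the stress law -/

section Law

variable {sigHat : Sym3 → Sym3}

lemma forall_inner_pos_comp_logRate_iff (hdiff : Differentiable ℝ sigHat)
    (hE : OrthEquivariant sigHat) (X : Sym3) :
    (∀ H : Sym3, H ≠ 0 → 0 < inner ℝ (((fderiv ℝ sigHat X).comp (logRate X)) H) H) ↔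
      ∀ H : Sym3, H ≠ 0 → 0 < inner ℝ (fderiv ℝ sigHat X H) H := by
  obtain ⟨Q, hQ, x, rfl⟩ := exists_congrSym_diagSym X
  obtain ⟨c, hc⟩ := hE.isBlockForm_fderiv hdiff x
  rw [forall_inner_pos_congrSym_iff (M := fderiv ℝ sigHat (diagSym x)) hQ
      fun H => hE.fderiv_congrSym hdiff hQ H,
    forall_inner_pos_congrSym_iff
      (M := (fderiv ℝ sigHat (diagSym x)).comp (logRate (diagSym x))) hQ fun H => by
        rw [ContinuousLinearMap.comp_apply, logRate_congrSym hQ,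
          hE.fderiv_congrSym hdiff hQ]; rfl,
    forall_inner_pos_comp_logRate_diagSym_iff hc]

lemma cspAt_iff_tstsMppAt (hdiff : Differentiable ℝ sigHat) (hE : OrthEquivariant sigHat)
    {F : Mat3} (hF : 0 < F.det) : CSPAt sigHat F ↔ TSTSMppAt sigHat (F * Fᵀ) := by
  rw [cspAt_iff hdiff hE hF, forall_inner_pos_comp_logRate_iff hdiff hE, TSTSMppAt]
  exact (isSymPosDef_symPart_iff _).symm

lemma exists_mul_transpose_eq {B : Mat3} (hB : B.PosDef) :
    ∃ F : Mat3, 0 < F.det ∧ F * Fᵀ = B := by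
  obtain ⟨X, rfl⟩ := exists_expSym_eq hB
  -- `F` is the positive square root of `B`.
  refine ⟨expSym ((1 / 2 : ℝ) • X), (expSym_posDef _).det_pos, ?_⟩
  rw [sym3_transpose, expSym_coe, ← Matrix.exp_add_of_commute _ _ (Commute.refl _),
    ← Submodule.coe_add, ← add_smul]
  norm_num [expSym_coe]

lemma csp_iff_tstsMpp (hdiff : Differentiable ℝ sigHat) (hE : OrthEquivariant sigHat) :
    CSP sigHat ↔ TSTSMpp sigHat := by
  constructor
  · intro h B hB
    obtain ⟨F, hF, rfl⟩ := exists_mul_transpose_eq hB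
    exact (cspAt_iff_tstsMppAt hdiff hE hF).1 (h F hF)
  · intro h F hF
    exact (cspAt_iff_tstsMppAt hdiff hE hF).2 (h _ (posDef_mul_transpose hF))

lemma tstsMpp_iff_stronglyMonotone (hdiff : Differentiable ℝ sigHat) :
    TSTSMpp sigHat ↔ StronglyMonotone sigHat := by
  constructor
  · intro h
    refine ⟨hdiff, fun X => ?_⟩
    have := h _ (expSym_posDef X)
    rw [TSTSMppAt, matLog_expSym] at this
    exact (isSymPosDef_symPart_iff _).1 this
  · intro h B _
    exact (isSymPosDef_symPart_iff _).2 (h.2 _)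

lemma StronglyMonotone.tstsMp (h : StronglyMonotone sigHat) : TSTSMp sigHat := by
  intro B₁ B₂ h₁ h₂ hne
  refine h.inner_sub_pos fun h0 => hne ?_
  rw [← expSym_matLog h₁, ← expSym_matLog h₂, h0]

/-! ### Principal stresses -/

lemma principalStress_eq :
    principalStress sigHat = fun y => diagPart (sigHat (diagSym ((2 : ℝ) • y))) := rfl

lemma hasFDerivAt_principalStress (hdiff : Differentiable ℝ sigHat) (y : E3) :
    HasFDerivAt (principalStress sigHat)
      ((diagPart.comp ((fderiv ℝ sigHat (diagSym ((2 : ℝ) • y))).comp diagSym)).comp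
        ((2 : ℝ) • ContinuousLinearMap.id ℝ E3)) y :=
  ((diagPart.hasFDerivAt.comp _ ((hdiff _).hasFDerivAt.comp _ diagSym.hasFDerivAt)).comp y
    ((2 : ℝ) • ContinuousLinearMap.id ℝ E3).hasFDerivAt :)

lemma inner_fderiv_principalStress (hdiff : Differentiable ℝ sigHat) (y d : E3) :
    inner ℝ (fderiv ℝ (principalStress sigHat) y d) d
      = 2 * inner ℝ (diagPart (fderiv ℝ sigHat (diagSym ((2 : ℝ) • y)) (diagSym d))) d := by
  rw [(hasFDerivAt_principalStress hdiff y).fderiv, ← real_inner_smul_left, ← map_smul,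
    ← map_smul, ← map_smul]
  rfl

lemma logVec_exp (y : E3) : logVec (fun i => Real.exp (y i)) = y := by
  ext i
  simp [logVec]

lemma principalTSTSMpp_iff (hdiff : Differentiable ℝ sigHat) :
    PrincipalTSTSMpp sigHat ↔ StronglyMonotone (principalStress sigHat) := by
  constructor
  · intro h
    refine ⟨fun y => (hasFDerivAt_principalStress hdiff y).differentiableAt, fun y => ?_⟩
    have := h (fun i => Real.exp (y i)) fun i => Real.exp_pos _
    rw [logVec_exp] at this
    exact (isSymPosDef_symPart_iff _).1 this
  · intro h lam _
    exact (isSymPosDef_symPart_iff _).2 (h.2 _)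

lemma coeff_mul_sub_principalStress (hdiff : Differentiable ℝ sigHat)
    (hE : OrthEquivariant sigHat) {y : E3} {c : Fin 3 → Fin 3 → ℝ}
    (hc : IsBlockForm (fderiv ℝ sigHat (diagSym ((2 : ℝ) • y))) c) {i j : Fin 3} (hij : i ≠ j) :
    c i j * (2 * (y i - y j)) = principalStress sigHat y i - principalStress sigHat y j := by
  have := hE.coeff_mul_sub hdiff hc hij
  rw [principalStress_eq, diagPart_apply, diagPart_apply, ← this]
  simp only [PiLp.smul_apply, smul_eq_mul]
  ring

lemma coeff_pos_of_stronglyMonotone_principalStress (hdiff : Differentiable ℝ sigHat)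
    (hE : OrthEquivariant sigHat) (hm : StronglyMonotone (principalStress sigHat)) {y : E3}
    {c : Fin 3 → Fin 3 → ℝ}
    (hc : IsBlockForm (fderiv ℝ sigHat (diagSym ((2 : ℝ) • y))) c) {i j : Fin 3} (hij : i ≠ j) :
    0 < c i j := by
  set e : E3 := EuclideanSpace.single i 1 - EuclideanSpace.single j 1 with he
  have ei : e i = 1 := by simp [he, hij]
  have ej : e j = -1 := by simp [he, hij.symm]
  have hinner : ∀ v : E3, inner ℝ v e = v i - v j := fun v => by
    rw [he, inner_sub_right, EuclideanSpace.inner_single_right, EuclideanSpace.inner_single_right]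
    simp
  have he0 : e ≠ 0 := fun h => by simp [h] at ei
  rcases eq_or_ne (y i) (y j) with hy | hy
  · have h := hE.two_mul_coeff hdiff hc hij (by simp [hy])
    rw [← he] at h
    have h2 := hm.2 y e he0
    rw [inner_fderiv_principalStress hdiff, ← h] at h2
    linarith
  · have h := coeff_mul_sub_principalStress hdiff hE hc hij
    -- Chosen so that `y - r • e` has equal entries `i` and `j`, hence equal principal stresses
    -- there. Monotonicity between this point and `y` fixes the sign of the stress gap at `y`.
    set r : ℝ := (y i - y j) / 2 with hr
    have hr0 : r ≠ 0 := div_ne_zero (sub_ne_zero.2 hy) two_ne_zero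
    obtain ⟨c', hc'⟩ := hE.isBlockForm_fderiv hdiff ((2 : ℝ) • (y - r • e))
    have h' := coeff_mul_sub_principalStress hdiff hE hc' hij
    have hz : (y - r • e) i - (y - r • e) j = 0 := by
      simp only [PiLp.sub_apply, PiLp.smul_apply, ei, ej, smul_eq_mul, hr]
      ring
    rw [hz, mul_zero, mul_zero] at h'
    have hne : y ≠ y - r • e := fun h0 => by
      have : r • e = 0 := sub_eq_self.1 h0.symm
      exact (smul_ne_zero hr0 he0) this
    have h3 := hm.inner_sub_pos hne
    rw [sub_sub_cancel, real_inner_smul_right, hinner, PiLp.sub_apply, PiLp.sub_apply] at h3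
    have h4 : 0 < c i j * (4 * r ^ 2) := by
      have : y i - y j = 2 * r := by rw [hr]; ring
      rw [this] at h
      calc 0 < _ := h3
        _ = r * ((principalStress sigHat y i - principalStress sigHat y j)
            - (principalStress sigHat (y - r • e) i - principalStress sigHat (y - r • e) j)) := by
          ring
        _ = _ := by rw [← h, ← h']; ring
    exact pos_of_mul_pos_left h4 (by positivity)

lemma stronglyMonotone_iff_principalStress (hdiff : Differentiable ℝ sigHat)
    (hE : OrthEquivariant sigHat) :
    StronglyMonotone sigHat ↔ StronglyMonotone (principalStress sigHat) := by
  constructor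
  · intro h
    refine ⟨fun y => (hasFDerivAt_principalStress hdiff y).differentiableAt, fun y d hd => ?_⟩
    obtain ⟨c, hc⟩ := hE.isBlockForm_fderiv hdiff ((2 : ℝ) • y)
    rw [inner_fderiv_principalStress hdiff]
    exact mul_pos two_pos ((hc.posDef_iff.1 (h.2 _)).1 d hd)
  · intro h
    refine ⟨hdiff, fun X => ?_⟩
    obtain ⟨Q, hQ, x, rfl⟩ := exists_congrSym_diagSym X
    obtain ⟨y, rfl⟩ : ∃ y : E3, (2 : ℝ) • y = x := ⟨(2 : ℝ)⁻¹ • x, smul_inv_smul₀ two_ne_zero x⟩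
    obtain ⟨c, hc⟩ := hE.isBlockForm_fderiv hdiff ((2 : ℝ) • y)
    refine (forall_inner_pos_congrSym_iff hQ fun H => hE.fderiv_congrSym hdiff hQ H).2
      (hc.posDef_iff.2 ⟨fun d hd => ?_, fun i j hij =>
        coeff_pos_of_stronglyMonotone_principalStress hdiff hE h hc hij⟩)
    have := h.2 y d hd
    rw [inner_fderiv_principalStress hdiff] at this
    linarith

/-- The stress gap is `c i j > 0` times twice the gap of logarithmic stretches, and `Real.log` is
increasing. -/
lemma StronglyMonotone.bakerEricksen (hE : OrthEquivariant sigHat) (h : StronglyMonotone sigHat) :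
    BakerEricksen sigHat := by
  intro lam hlam i j hne
  have hij : i ≠ j := fun h => hne (congrArg lam h)
  obtain ⟨c, hc⟩ := hE.isBlockForm_fderiv h.1 ((2 : ℝ) • logVec lam)
  have hpos := (hc.posDef_iff.1 (h.2 _)).2 i j hij
  rw [← coeff_mul_sub_principalStress h.1 hE hc hij]
  change 0 < c i j * (2 * (Real.log (lam i) - Real.log (lam j))) * (lam i - lam j)
  rcases hne.lt_or_gt with hlt | hlt
  · have := Real.log_lt_log (hlam i) hlt
    exact mul_pos_of_neg_of_neg (mul_neg_of_pos_of_neg hpos (by linarith)) (by linarith)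
  · have := Real.log_lt_log (hlam j) hlt
    exact mul_pos (mul_pos hpos (by linarith)) (by linarith)

end Law

end TensorAnalysis

/-- For a differentiable isotropic Cauchy-elastic law `σ(B) = σ̂(log B)`, the corotational
stability postulate is equivalent, at each deformation gradient `F` and hence globally, to
positive definiteness of `sym D σ̂(log B)`, `B = F Fᵀ`; globally also to strong
Hilbert-monotonicity of `σ̂` and to its version for principal stresses. It implies TSTS-M⁺ and
the strict Baker-Ericksen inequalities. -/
theorem mainTheorem1 (sigHat : Sym3 → Sym3) (hdiff : Differentiable ℝ sigHat)
    (hiso : IsIsotropic (cauchyStress sigHat)) :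
    (∀ F : Mat3, 0 < F.det → (CSPAt sigHat F ↔ TSTSMppAt sigHat (F * Fᵀ))) ∧
    (CSP sigHat ↔ TSTSMpp sigHat) ∧
    (CSP sigHat ↔ StronglyMonotone sigHat) ∧
    (CSP sigHat ↔ PrincipalTSTSMpp sigHat) ∧
    (CSP sigHat → TSTSMp sigHat) ∧
    (CSP sigHat → BakerEricksen sigHat) := by
  have hE := hiso.orthEquivariant
  have h1 := csp_iff_tstsMpp hdiff hE
  have h2 := h1.trans (tstsMpp_iff_stronglyMonotone hdiff)
  exact ⟨fun F hF => cspAt_iff_tstsMppAt hdiff hE hF, h1, h2,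
    h2.trans ((stronglyMonotone_iff_principalStress hdiff hE).trans
      (principalTSTSMpp_iff hdiff).symm),
    fun h => (h2.1 h).tstsMp, fun h => (h2.1 h).bakerEricksen hE⟩
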